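/- Let $X=(X_t)_{t\ge 0}$ be a real-valued Lévy process with $X_0=0$ on a probability space $(\Omega,\mathcal F,P)$ such that $E[e^{2X_1}]<\infty$, $E[|X_1|^n]<\infty$ for $n=1,\dots,5$, and $\mathrm{Var}(X_1)>0$. Put $\mu=E[X_1]$, $\sigma=\sqrt{\mathrm{Var}(X_1)}$, $$\mathrm{Skew}=\frac{E[(X_1-\mu)^3]}{\sigma^3},\qquad \mathrm{ExKurt}=\frac{E[(X_1-\mu)^4]}{\sigma^4}-3 .$$ For $\lambda\in(0,1]$ let $X^\lambda_t=(1-\tfrac1\lambda)\mu t+\lambda X_{t/\lambda^2}$, and let $X^0_t=\mu t+\sigma W_t$ with a standard Brownian motion $W$ (possibly on another probability space). For $\lambda\in[0,1]$ let $\kappa^\lambda$ be the cumulant generating function of $X^\lambda$, i.e. the unique continuous function on $D^\lambda=\{z\in\mathbb C: E[e^{\mathrm{Re}(z)X^\lambda_1}]<\infty\}$ with $E[e^{zX^\lambda_t}]=e^{t\kappa^\lambda(z)}$ for all $t\ge0$, $z\in D^\lambda$. Put $\bar\kappa^\lambda(y,z)=\kappa^\lambda(y+z)-\kappa^\lambda(y)-\kappa^\lambda(z)$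 and let $q(\lambda)=\Lambda^\lambda=\kappa^\lambda(1)/\bar\kappa^\lambda(1,1)$ be the mean-variance ratio in the model with parameter $\lambda$; $\Lambda=\Lambda^1$ is the mean-variance ratio for $X$ itself. Then $q$ is twice continuously differentiable on $[0,1)$, and also on the closed interval $[0,1]$ if $2$ is an interior point of $D^1$. With one-sided derivatives at $0$, the terms $\Lambda^{(0)}=q(0)$, $\Lambda^{(1)}=q'(0)$, $\Lambda^{(2)}=q''(0)$ are $$\Lambda^{(0)}=\frac{\mu+\frac12\sigma^2}{\sigma^2},\qquad \Lambda^{(1)}=\mathrm{Skew}\,\sigma\left(\tfrac16-\Lambda^{(0)}\right),$$ $$\Lambda^{(2)}=\mathrm{Skew}^2\sigma^2\left(2\Lambda^{(0)}-\tfrac13\right)+\tfrac16\,\mathrm{ExKurt}\,\sigma^2\left(\tfrac12-7\Lambda^{(0)}\right),$$ so that the second-order approximation $q(0)+q'(0)+\tfrac12q''(0)$ to $\Lambda$ equals $\Lambda^{(0)}+\Lambda^{(1)}+\tfrac12\Lambda^{(2)}$. -/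

import Mathlib

open MeasureTheory ProbabilityTheory Filter Topology
open scoped NNReal

noncomputable section

/-- A real-valued Lévy process with time set `[0, ∞)`. -/
structure IsLevyProcess {Ω : Type*} [MeasurableSpace Ω] (X : ℝ≥0 → Ω → ℝ) (P : Measure Ω) :
    Prop where
  measurable : ∀ t, Measurable (X t)
  zero : ∀ᵐ ω ∂P, X 0 ω = 0
  indepIncrements : HasIndepIncrements X P
  stationaryIncrements : ∀ s t, IdentDistrib (fun ω ↦ X (s + t) ω - X s ω) (X t) P P
  continuousInProbability : ∀ t, TendstoInMeasure P X (𝓝 t) (X t)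
  cadlag : ∀ᵐ ω ∂P, ∀ t, ContinuousWithinAt (fun s ↦ X s ω) (Set.Ici t) t ∧
    ∃ l, Tendsto (fun s ↦ X s ω) (𝓝[<] t) (𝓝 l)

/-- The standing moment conditions on the Lévy process. -/
structure MomentConditions {Ω : Type*} [MeasurableSpace Ω] (X : ℝ≥0 → Ω → ℝ) (P : Measure Ω) :
    Prop where
  expMoment : Integrable (fun ω ↦ Real.exp (2 * X 1 ω)) P
  moments : ∀ n ∈ Finset.Icc 1 5, Integrable (fun ω ↦ |X 1 ω| ^ n) P
  variance_pos : 0 < variance (X 1) P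

/-- Skewness of a random variable. -/
def skewness {Ω : Type*} [MeasurableSpace Ω] (Y : Ω → ℝ) (P : Measure Ω) : ℝ :=
  (∫ ω, (Y ω - ∫ ω', Y ω' ∂P) ^ 3 ∂P) / √(variance Y P) ^ 3

/-- Excess kurtosis of a random variable. -/
def excessKurtosis {Ω : Type*} [MeasurableSpace Ω] (Y : Ω → ℝ) (P : Measure Ω) : ℝ :=
  (∫ ω, (Y ω - ∫ ω', Y ω' ∂P) ^ 4 ∂P) / √(variance Y P) ^ 4 - 3

/-- The drift rate `μ = E[X₁]`. -/
def driftRate {Ω : Type*} [MeasurableSpace Ω] (X : ℝ≥0 → Ω → ℝ) (P : Measure Ω) : ℝ :=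
  ∫ ω, X 1 ω ∂P

/-- The volatility `σ = √Var(X₁)`. -/
def volatility {Ω : Type*} [MeasurableSpace Ω] (X : ℝ≥0 → Ω → ℝ) (P : Measure Ω) : ℝ :=
  √(variance (X 1) P)

/-- The domain `D = {y ∈ ℂ : E[exp(Re(y) Y₁)] < ∞}`. -/
def expDomain {Ω : Type*} [MeasurableSpace Ω] (Y : ℝ≥0 → Ω → ℝ) (P : Measure Ω) : Set ℂ :=
  {y | Integrable (fun ω ↦ Real.exp (y.re * Y 1 ω)) P}

/-- `κ` is a cumulant generating function of the process `Y`: a continuous function on the domain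
`D` with `E[exp(z Y_t)] = exp(t κ(z))` for all `t ≥ 0`, `z ∈ D`. -/
structure IsCumulantGenFun {Ω : Type*} [MeasurableSpace Ω] (Y : ℝ≥0 → Ω → ℝ) (P : Measure Ω)
    (κ : ℂ → ℂ) : Prop where
  continuousOn : ContinuousOn κ (expDomain Y P)
  integral_eq : ∀ z ∈ expDomain Y P, ∀ t : ℝ≥0,
    ∫ ω, Complex.exp (z * (Y t ω : ℂ)) ∂P = Complex.exp ((t : ℂ) * κ z)

open Classical in
/-- The cumulant generating function of the process `Y`: for `z ∈ D`, `κ(z)` is the number `w`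
with `E[exp(z Y_t)] = exp(t w)` for all real `t ≥ 0`. Since all real times occur, `w` is determined
pointwise by this equation, see `cumulantGenFun_eq`; the value is `0` where there is no such `w`. -/
def cumulantGenFun {Ω : Type*} [MeasurableSpace Ω] (Y : ℝ≥0 → Ω → ℝ) (P : Measure Ω)
    (z : ℂ) : ℂ :=
  if h : z ∈ expDomain Y P ∧ ∃ w : ℂ, ∀ t : ℝ≥0,
      ∫ ω, Complex.exp (z * (Y t ω : ℂ)) ∂P = Complex.exp ((t : ℂ) * w)
  then h.2.choose else 0

/-- An exponent is determined by its exponentials at all times `t ≥ 0`. -/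
theorem eq_of_exp_mul_eq {v w : ℂ}
    (h : ∀ t : ℝ≥0, Complex.exp ((t : ℂ) * v) = Complex.exp ((t : ℂ) * w)) : v = w := by
  have hd : ∀ u : ℂ, HasDerivWithinAt (fun t : ℝ ↦ Complex.exp ((t : ℂ) * u)) u
      (Set.Ici 0) 0 := by
    intro u
    have h1 : HasDerivAt (fun t : ℝ ↦ (t : ℂ) * u) u 0 := by
      simpa using (Complex.ofRealCLM.hasDerivAt (x := (0 : ℝ))).mul_const u
    simpa using h1.cexp.hasDerivWithinAt
  have hv : HasDerivWithinAt (fun t : ℝ ↦ Complex.exp ((t : ℂ) * v)) w (Set.Ici 0) 0 := by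
    refine (hd w).congr (fun t ht ↦ ?_) ?_
    · exact h ⟨t, ht⟩
    · simp
  exact (uniqueDiffOn_Ici (0 : ℝ) 0 Set.self_mem_Ici).eq_deriv _ (hd v) hv

/-- The cumulant generating function agrees with every function that has its defining
properties. -/
theorem cumulantGenFun_eq {Ω : Type*} [MeasurableSpace Ω] {Y : ℝ≥0 → Ω → ℝ} {P : Measure Ω}
    {κ : ℂ → ℂ} (hκ : IsCumulantGenFun Y P κ) {z : ℂ} (hz : z ∈ expDomain Y P) :
    cumulantGenFun Y P z = κ z := by
  have h : z ∈ expDomain Y P ∧ ∃ w : ℂ, ∀ t : ℝ≥0,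
      ∫ ω, Complex.exp (z * (Y t ω : ℂ)) ∂P = Complex.exp ((t : ℂ) * w) :=
    ⟨hz, κ z, hκ.integral_eq z hz⟩
  rw [cumulantGenFun, dif_pos h]
  refine eq_of_exp_mul_eq fun t ↦ ?_
  rw [← h.2.choose_spec t, hκ.integral_eq z hz t]

/-- The process `X^λ_t = (1 - 1/λ) μ t + λ X_{t/λ²}` for `λ > 0`. -/
def levyCurve {Ω : Type*} [MeasurableSpace Ω] (X : ℝ≥0 → Ω → ℝ) (P : Measure Ω) (l : ℝ) :
    ℝ≥0 → Ω → ℝ :=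
  fun t ω ↦ (1 - 1 / l) * driftRate X P * t + l * X (t / (Real.toNNReal l) ^ 2) ω

/-- The limiting process `X^0_t = μ t + σ W_t`. -/
def brownianLimit {Ω Ω' : Type*} [MeasurableSpace Ω] (X : ℝ≥0 → Ω → ℝ)
    (P : Measure Ω) (W : ℝ≥0 → Ω' → ℝ) : ℝ≥0 → Ω' → ℝ :=
  fun t ω ↦ driftRate X P * t + volatility X P * W t ω

/-- The cumulant generating function `κ^λ` of `X^λ`; the Brownian motion `W` driving `X^0` may
live on a probability space of its own. -/
def curveCumulant {Ω Ω' : Type*} [MeasurableSpace Ω] [MeasurableSpace Ω'] (X : ℝ≥0 → Ω → ℝ)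
    (P : Measure Ω) (W : ℝ≥0 → Ω' → ℝ) (P' : Measure Ω') (l : ℝ) : ℂ → ℂ :=
  if l = 0 then cumulantGenFun (brownianLimit X P W) P'
  else cumulantGenFun (levyCurve X P l) P

/-- `κ̄(y, z) = κ(y + z) - κ(y) - κ(z)`. -/
def kappaBar (κ : ℂ → ℂ) (y z : ℂ) : ℂ := κ (y + z) - κ y - κ z

/-- The mean-variance ratio `Λ^λ = κ^λ(1) / κ̄^λ(1, 1)` in the model with parameter `λ`. -/
def meanVarianceRatio {Ω Ω' : Type*} [MeasurableSpace Ω] [MeasurableSpace Ω'] (X : ℝ≥0 → Ω → ℝ)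
    (P : Measure Ω) (W : ℝ≥0 → Ω' → ℝ) (P' : Measure Ω') (l : ℝ) : ℂ :=
  curveCumulant X P W P' l 1 / kappaBar (curveCumulant X P W P' l) 1 1

/-- The `n`-th (one-sided) derivative at `0` of a function `q` on `[0, 1]`. -/
def approxTerm (q : ℝ → ℂ) (n : ℕ) : ℂ := iteratedDerivWithin n q (Set.Icc 0 1) 0

/-- The second-order approximation `q(0) + q'(0) + q''(0)/2` to `q(1)`. -/
def secondOrderApprox (q : ℝ → ℂ) : ℂ :=
  approxTerm q 0 + approxTerm q 1 + 1 / 2 * approxTerm q 2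

end

/-!
Write `κ(u) = log E[exp(u X₁)] = μ u + u² F(u)` with `F(0) = σ² / 2`. Scaling gives
`κ^λ(u) = μ u + u² F(λ u)`, also for `λ = 0`, and hence
`q(λ) = (μ + F(λ)) / (4 F(2λ) - 2 F(λ))`. For `λ > 0` the denominator is
`(κ(2λ) - 2 κ(λ)) / λ²`, which is positive because `exp(λ X₁)` has positive variance.
The function `κ` is four times continuously differentiable up to the boundary point `0`, so that
`F(u) = ∫₀¹ (1 - t) κ''(t u) dt` is twice continuously differentiable there; the derivatives of
`F` at `0` are multiples of the cumulants of `X₁`, and those of `q` follow from Leibniz' rule for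
`q(λ) (4 F(2λ) - 2 F(λ)) = μ + F(λ)`.

That `E[exp(u X_t)] = exp(t κ(u))` is Cauchy's functional equation for `t ↦ log E[exp(u X_t)]`,
whose regularity requirement is met by a lower bound near `t = 0`, a consequence of continuity in
probability.
-/

theorem pos_of_map_add_eq_mul {φ : ℝ≥0 → ℝ} (hadd : ∀ s t, φ (s + t) = φ s * φ t)
    (hnonneg : ∀ t, 0 ≤ φ t) (hone : 0 < φ 1) (t : ℝ≥0) : 0 < φ t := by
  have hzero : φ 0 = 1 := by
    have h := hadd 0 1
    rw [zero_add] at h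
    exact mul_right_cancel₀ hone.ne' (by rw [← h, one_mul])
  have hnat : ∀ n : ℕ, φ n = φ 1 ^ n := by
    intro n
    induction n with
    | zero => simpa using hzero
    | succ n ih => rw [Nat.cast_succ, hadd, ih, pow_succ]
  obtain ⟨n, hn⟩ := exists_nat_ge t
  have hprod : φ t * φ (n - t) = φ 1 ^ n := by rw [← hadd, add_tsub_cancel_of_le hn, hnat]
  exact pos_of_mul_pos_left (hprod ▸ pow_pos hone n) (hnonneg _)

/-- The odd extension of an additive function on `[0, ∞)` to an additive function on `ℝ`. -/
def oddExtension (h : ℝ≥0 → ℝ) (hadd : ∀ s t, h (s + t) = h s + h t) : ℝ →+ ℝ :=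
  AddMonoidHom.mk' (fun x ↦ h x.toNNReal - h (-x).toNNReal) fun x y ↦ by
    have hparts : (x + y).toNNReal + ((-x).toNNReal + (-y).toNNReal) =
        (-(x + y)).toNNReal + (x.toNNReal + y.toNNReal) := by
      ext
      simp only [NNReal.coe_add, Real.coe_toNNReal']
      grind
    have hsum := congrArg h hparts
    simp only [hadd] at hsum
    linarith

theorem oddExtension_coe {h : ℝ≥0 → ℝ} (hadd : ∀ s t, h (s + t) = h s + h t) (t : ℝ≥0) :
    oddExtension h hadd t = h t := by
  have hzero : h 0 = 0 := by simpa using hadd 0 0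
  have hneg : (-(t : ℝ)).toNNReal = 0 := Real.toNNReal_of_nonpos (neg_nonpos.2 t.2)
  simp [oddExtension, hneg, hzero]

theorem eq_mul_of_map_add_of_eventually_ge {h : ℝ≥0 → ℝ}
    (hadd : ∀ s t, h (s + t) = h s + h t) {C : ℝ} (hC : ∀ᶠ t in 𝓝 0, C ≤ h t) (t : ℝ≥0) :
    h t = t * h 1 := by
  obtain ⟨δ, hδ, hge⟩ := (nhds_bot_basis_Iic (α := ℝ≥0)).eventually_iff.1 hC
  have hle : ∀ t ≤ δ, h t ≤ h δ - C := fun t ht ↦ by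
    have hδt : h δ = h t + h (δ - t) := by rw [← hadd, add_tsub_cancel_of_le ht]
    linarith [hge (tsub_le_self : δ - t ≤ δ)]
  have hcont : Continuous (oddExtension h hadd) := by
    refine AddMonoidHom.continuous_of_isBounded_nhds_zero _
      (Icc_mem_nhds (neg_lt_zero.2 (NNReal.coe_pos.2 hδ)) (NNReal.coe_pos.2 hδ)) ?_
    refine (Metric.isBounded_Icc (C - (h δ - C)) (h δ - C - C)).subset ?_
    rintro _ ⟨x, hx, rfl⟩
    have hpos : x.toNNReal ≤ δ := Real.toNNReal_le_iff_le_coe.2 hx.2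
    have hneg : (-x).toNNReal ≤ δ := Real.toNNReal_le_iff_le_coe.2 (neg_le.1 hx.1)
    exact ⟨sub_le_sub (hge hpos) (hle _ hneg), sub_le_sub (hle _ hpos) (hge hneg)⟩
  have hlin := map_real_smul (oddExtension h hadd) hcont t ((1 : ℝ≥0) : ℝ)
  rwa [NNReal.coe_one, smul_eq_mul, mul_one, ← NNReal.coe_one, oddExtension_coe,
    oddExtension_coe, smul_eq_mul] at hlin

theorem eq_exp_mul_log_of_map_add_eq_mul {φ : ℝ≥0 → ℝ} (hadd : ∀ s t, φ (s + t) = φ s * φ t)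
    (hnonneg : ∀ t, 0 ≤ φ t) (hone : 0 < φ 1) {c : ℝ} (hc : 0 < c)
    (hge : ∀ᶠ t in 𝓝 0, c ≤ φ t) (t : ℝ≥0) : φ t = Real.exp (t * Real.log (φ 1)) := by
  have hpos := pos_of_map_add_eq_mul hadd hnonneg hone
  have hlog : Real.log (φ t) = t * Real.log (φ 1) :=
    eq_mul_of_map_add_of_eventually_ge (h := fun t ↦ Real.log (φ t))
      (fun s t ↦ by rw [hadd, Real.log_mul (hpos s).ne' (hpos t).ne'])
      (hge.mono fun t ht ↦ Real.log_le_log hc ht) t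
  rw [← hlog, Real.exp_log (hpos t)]

namespace IsLevyProcess

variable {Ω : Type*} [MeasurableSpace Ω] {P : Measure Ω} {X : ℝ≥0 → Ω → ℝ}

theorem mgf_add (hX : IsLevyProcess X P) (s t : ℝ≥0) (u : ℝ) :
    mgf (X (s + t)) P u = mgf (X s) P u * mgf (X t) P u := by
  have hindep : X s ⟂ᵢ[P] (X (s + t) - X s) :=
    hX.indepIncrements.indepFun_eval_sub zero_le le_self_add hX.zero
  have hX_meas := hX.measurable
  calc mgf (X (s + t)) P u = mgf (X s + (X (s + t) - X s)) P u := by rw [add_sub_cancel]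
    _ = mgf (X s) P u * mgf (X (s + t) - X s) P u :=
      hindep.mgf_add' (hX_meas s).aestronglyMeasurable
        ((hX_meas (s + t)).sub (hX_meas s)).aestronglyMeasurable
    _ = mgf (X s) P u * mgf (X t) P u := by
      rw [← mgf_congr_identDistrib (hX.stationaryIncrements s t)]; rfl

variable [IsProbabilityMeasure P]

theorem mgf_pos (hX : IsLevyProcess X P) {u : ℝ}
    (hu : Integrable (fun ω ↦ Real.exp (u * X 1 ω)) P) (t : ℝ≥0) : 0 < mgf (X t) P u :=
  pos_of_map_add_eq_mul (fun s t ↦ hX.mgf_add s t u) (fun _ ↦ mgf_nonneg) (mgf_pos_iff.2 hu) t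

theorem eventually_measureReal_abs_le_one_ge (hX : IsLevyProcess X P) :
    ∀ᶠ t in 𝓝 0, 1 / 2 ≤ P.real {ω | |X t ω| ≤ 1} := by
  have htail := tendstoInMeasure_iff_measureReal_norm.1 (hX.continuousInProbability 0) 1 one_pos
  filter_upwards [htail.eventually (gt_mem_nhds one_half_pos)] with t ht
  have hmeas : MeasurableSet {ω | |X t ω| ≤ 1} :=
    measurableSet_le (hX.measurable t).norm measurable_const
  have hsub : {ω | |X t ω| ≤ 1}ᶜ ≤ᵐ[P] {ω | 1 ≤ ‖X t ω - X 0 ω‖} := by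
    filter_upwards [hX.zero] with ω hω hgt
    change 1 ≤ ‖X t ω - X 0 ω‖
    rw [hω, sub_zero]
    exact (not_le.1 hgt).le
  have hcompl : P.real {ω | |X t ω| ≤ 1}ᶜ ≤ 1 / 2 :=
    (ENNReal.toReal_mono (measure_ne_top _ _) (measure_mono_ae hsub)).trans ht.le
  rw [probReal_compl_eq_one_sub hmeas] at hcompl
  linarith

theorem eventually_mgf_ge (hX : IsLevyProcess X P) {u : ℝ}
    (hu : Integrable (fun ω ↦ Real.exp (u * X 1 ω)) P) :
    ∀ᶠ t in 𝓝 0, Real.exp (-|u|) * (1 / 2) ≤ mgf (X t) P u := by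
  filter_upwards [hX.eventually_measureReal_abs_le_one_ge] with t hprob
  have hsub : {ω | |X t ω| ≤ 1} ⊆ {ω | Real.exp (-|u|) ≤ Real.exp (u * X t ω)} := fun ω hω ↦ by
    refine Real.exp_le_exp.2 (neg_le_of_abs_le ?_)
    rw [abs_mul]
    exact mul_le_of_le_one_right (abs_nonneg u) hω
  calc Real.exp (-|u|) * (1 / 2)
      ≤ Real.exp (-|u|) * P.real {ω | Real.exp (-|u|) ≤ Real.exp (u * X t ω)} := by
        gcongr
        exact hprob.trans (measureReal_mono hsub)
    _ ≤ mgf (X t) P u := mul_meas_ge_le_integral_of_nonneg (ae_of_all _ fun _ ↦ Real.exp_nonneg _)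
        (mgf_pos_iff.1 (hX.mgf_pos hu t)) _

theorem mgf_eq_exp (hX : IsLevyProcess X P) {u : ℝ}
    (hu : Integrable (fun ω ↦ Real.exp (u * X 1 ω)) P) (t : ℝ≥0) :
    mgf (X t) P u = Real.exp (t * cgf (X 1) P u) :=
  eq_exp_mul_log_of_map_add_eq_mul (fun s t ↦ hX.mgf_add s t u) (fun _ ↦ mgf_nonneg)
    (mgf_pos_iff.2 hu) (by positivity) (hX.eventually_mgf_ge hu) t

end IsLevyProcess

theorem exists_contDiff_eqOn_Icc {E : Type*} [NormedAddCommGroup E] [NormedSpace ℝ E]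
    [CompleteSpace E] {n : ℕ} {a b : ℝ} (hab : a < b) {f : ℝ → E}
    (hf : ContDiffOn ℝ n f (Set.Icc a b)) : ∃ g, ContDiff ℝ n g ∧ Set.EqOn g f (Set.Icc a b) := by
  induction n generalizing f with
  | zero =>
    exact ⟨Set.IccExtend hab.le ((Set.Icc a b).domRestrict f),
      contDiff_zero.2 (continuousOn_iff_continuous_domRestrict.1 hf.continuousOn).Icc_extend',
      fun x hx ↦ Set.IccExtend_of_mem hab.le _ hx⟩
  | succ n ih =>
    rw [Nat.cast_succ, contDiffOn_succ_iff_derivWithin (uniqueDiffOn_Icc hab)] at hf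
    obtain ⟨g', hg', hgf'⟩ := ih hf.2.2
    have hderiv : ∀ x, HasDerivAt (fun x ↦ f a + ∫ t in a..x, g' t) (g' x) x := fun x ↦
      (hg'.continuous.integral_hasStrictDerivAt a x).hasDerivAt.const_add _
    refine ⟨fun x ↦ f a + ∫ t in a..x, g' t, ?_, fun x hx ↦ ?_⟩
    · rw [Nat.cast_succ, contDiff_succ_iff_deriv]
      exact ⟨fun x ↦ (hderiv x).differentiableAt, by simp,
        by rwa [show deriv (fun x ↦ f a + ∫ t in a..x, g' t) = g' from
          funext fun x ↦ (hderiv x).deriv]⟩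
    · have hFTC : ∫ t in a..x, g' t = f x - f a := by
        refine intervalIntegral.integral_eq_sub_of_hasDeriv_right_of_le hx.1
          (hf.1.continuousOn.mono (Set.Icc_subset_Icc_right hx.2)) (fun t ht ↦ ?_)
          (hg'.continuous.intervalIntegrable a x)
        have htab : t ∈ Set.Ioo a b := ⟨ht.1, ht.2.trans_le hx.2⟩
        rw [hgf' (Set.Ioo_subset_Icc_self htab)]
        exact ((hf.1 t (Set.Ioo_subset_Icc_self htab)).hasDerivWithinAt.hasDerivAt
          (Icc_mem_nhds htab.1 htab.2)).hasDerivWithinAt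
      simp [hFTC]

section ParametricIntegral

variable {w g : ℝ → ℝ} {n : ℕ}

theorem hasDerivAt_integral_mul_comp_mul (hw : Continuous w) (hg : ContDiff ℝ 1 g) (x : ℝ) :
    HasDerivAt (fun x ↦ ∫ t in 0..1, w t * g (t * x))
      (∫ t in 0..1, t * w t * deriv g (t * x)) x := by
  have : Continuous (deriv g) := hg.continuous_deriv le_rfl
  obtain ⟨C, hC⟩ := ((isCompact_Icc (a := (0 : ℝ)) (b := 1)).prod
    (isCompact_closedBall x 1)).exists_bound_of_continuousOn
    (f := fun p ↦ p.1 * w p.1 * deriv g (p.1 * p.2)) (by fun_prop)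
  refine (intervalIntegral.hasDerivAt_integral_of_dominated_loc_of_deriv_le (bound := fun _ ↦ C)
    (Metric.closedBall_mem_nhds x one_pos) (Eventually.of_forall fun y ↦ ?_) ?_ ?_
    (ae_of_all _ fun t ht y hy ↦ hC (t, y) ⟨?_, hy⟩) intervalIntegrable_const
    (ae_of_all _ fun t _ y _ ↦ ?_)).2
  · exact Continuous.aestronglyMeasurable (by fun_prop)
  · exact Continuous.intervalIntegrable (by fun_prop) _ _
  · exact Continuous.aestronglyMeasurable (by fun_prop)
  · rw [Set.uIoc_of_le zero_le_one] at ht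
    exact Set.Ioc_subset_Icc_self ht
  · have hcomp := ((hg.differentiable one_ne_zero).differentiableAt.hasDerivAt.comp y
      (hasDerivAt_const_mul t)).const_mul (w t)
    exact hcomp.congr_deriv (by ring)

theorem contDiff_integral_mul_comp_mul (hw : Continuous w) (hg : ContDiff ℝ n g) :
    ContDiff ℝ n fun x ↦ ∫ t in 0..1, w t * g (t * x) := by
  induction n generalizing w g with
  | zero =>
    exact contDiff_zero.2
      (intervalIntegral.continuous_parametric_intervalIntegral_of_continuous' (by fun_prop) 0 1)
  | succ n ih =>
    have hderiv := hasDerivAt_integral_mul_comp_mul hw (hg.of_le (by simp))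
    rw [Nat.cast_succ, contDiff_succ_iff_deriv] at hg ⊢
    refine ⟨fun x ↦ (hderiv x).differentiableAt, by simp, ?_⟩
    rw [funext fun x ↦ (hderiv x).deriv]
    exact ih (continuous_id.mul hw) hg.2.2

theorem iteratedDeriv_integral_mul_comp_mul (hw : Continuous w) (hg : ContDiff ℝ n g) :
    iteratedDeriv n (fun x ↦ ∫ t in 0..1, w t * g (t * x)) =
      fun x ↦ ∫ t in 0..1, t ^ n * w t * iteratedDeriv n g (t * x) := by
  induction n generalizing w g with
  | zero => simp
  | succ n ih =>
    have hderiv := hasDerivAt_integral_mul_comp_mul hw (hg.of_le (by simp))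
    rw [Nat.cast_succ, contDiff_succ_iff_deriv] at hg
    rw [iteratedDeriv_succ', funext fun x ↦ (hderiv x).deriv,
      ih (w := fun t ↦ t * w t) (continuous_id.mul hw) hg.2.2]
    simp only [iteratedDeriv_succ', pow_succ, mul_assoc]

end ParametricIntegral

theorem exists_contDiff_eq_add_sq_mul {n : ℕ} {f : ℝ → ℝ} (hf : ContDiff ℝ (n + 2) f) :
    ∃ F, ContDiff ℝ n F ∧ (∀ x, f x = f 0 + deriv f 0 * x + x ^ 2 * F x) ∧
      ∀ k ≤ n, iteratedDeriv k F 0 = iteratedDeriv (k + 2) f 0 / ((k + 1) * (k + 2)) := by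
  have hf'' : ContDiff ℝ n (iteratedDeriv 2 f) := by
    rw [iteratedDeriv_eq_iterate]
    exact hf.iterate_deriv' n 2
  have hw : Continuous fun t : ℝ ↦ 1 - t := by fun_prop
  refine ⟨fun x ↦ ∫ t in 0..1, (1 - t) * iteratedDeriv 2 f (t * x),
    contDiff_integral_mul_comp_mul hw hf'', fun x ↦ ?_, fun k hk ↦ ?_⟩
  · have htaylor := map_add_eq_sum_add_integral_iteratedFDeriv (f := f) (x := 0) (y := x) (n := 1)
      fun t _ ↦ (hf.of_le (by norm_cast; omega)).contDiffAt
    have hrem : x ^ 2 * ∫ t in 0..1, (1 - t) * iteratedDeriv 2 f (t * x) =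
        ∫ t in 0..1, (1 - t) * (x ^ 2 * iteratedDeriv 2 f (t * x)) := by
      rw [← intervalIntegral.integral_const_mul]
      simp only [mul_left_comm]
    rw [hrem]
    simpa [iteratedFDeriv_apply_eq_iteratedDeriv_mul_prod, Finset.sum_range_succ,
      mul_comm x] using htaylor
  · rw [iteratedDeriv_integral_mul_comp_mul hw (hf''.of_le (by exact_mod_cast hk))]
    have hbeta : ∫ t in (0 : ℝ)..1, t ^ k * (1 - t) = 1 / ((k + 1) * (k + 2)) := by
      simp only [mul_sub, mul_one, ← pow_succ]
      rw [intervalIntegral.integral_sub (by simp) (by simp), integral_pow, integral_pow]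
      push_cast
      field_simp
      ring
    simp only [mul_zero, intervalIntegral.integral_mul_const, hbeta, iteratedDeriv_eq_iterate,
      ← Function.iterate_add_apply, one_div_mul_eq_div]

theorem iteratedDerivWithin_eq_of_hasDerivWithinAt {E : Type*} [NormedAddCommGroup E]
    [NormedSpace ℝ E] {s : Set ℝ} (hs : UniqueDiffOn ℝ s) {n : ℕ} {f : ℕ → ℝ → E}
    (hf : ∀ k < n, ∀ x ∈ s, HasDerivWithinAt (f k) (f (k + 1) x) s x) {k : ℕ} (hk : k ≤ n) :
    Set.EqOn (iteratedDerivWithin k (f 0) s) (f k) s := by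
  induction k with
  | zero => exact fun x _ ↦ by rw [iteratedDerivWithin_zero]
  | succ k ih =>
    intro x hx
    have hprev := ih (Nat.le_of_succ_le hk)
    rw [iteratedDerivWithin_succ, derivWithin_congr hprev (hprev hx)]
    exact (hf k hk x hx).derivWithin (hs x hx)

theorem contDiffOn_of_hasDerivWithinAt {E : Type*} [NormedAddCommGroup E] [NormedSpace ℝ E]
    {s : Set ℝ} (hs : UniqueDiffOn ℝ s) {n : ℕ} {f : ℕ → ℝ → E}
    (hf : ∀ k < n, ∀ x ∈ s, HasDerivWithinAt (f k) (f (k + 1) x) s x)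
    (hcont : ContinuousOn (f n) s) : ContDiffOn ℝ n (f 0) s := by
  have heq := fun {k} ↦ iteratedDerivWithin_eq_of_hasDerivWithinAt hs hf (k := k)
  have hdiff : ∀ k < n, DifferentiableOn ℝ (f k) s := fun k hk x hx ↦
    (hf k hk x hx).differentiableWithinAt
  refine contDiffOn_of_continuousOn_differentiableOn_deriv (fun k hk ↦ ?_) fun k hk ↦ ?_
  · refine ContinuousOn.congr ?_ (heq (Nat.cast_le.1 hk))
    rcases (Nat.cast_le.1 hk).lt_or_eq with hlt | rfl
    · exact (hdiff k hlt).continuousOn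
    · exact hcont
  · have hlt : k < n := Nat.cast_lt.1 hk
    exact (hdiff k hlt).congr (heq hlt.le)

section MomentGeneratingFunction

variable {Ω : Type*} [MeasurableSpace Ω] {P : Measure Ω} {Y : Ω → ℝ} {b c : ℝ} {n : ℕ}

/-- The exponentially weighted moment `E[Yⁿ exp(u Y)]`, which is the `n`-th derivative at `u` of the
moment generating function of `Y` wherever the latter is smooth. -/
noncomputable def expMoment (Y : Ω → ℝ) (P : Measure Ω) (n : ℕ) (u : ℝ) : ℝ :=
  ∫ ω, Y ω ^ n * Real.exp (u * Y ω) ∂P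

theorem expMoment_zero_left (Y : Ω → ℝ) (P : Measure Ω) : expMoment Y P 0 = mgf Y P := by
  ext u
  simp [expMoment, mgf]

theorem expMoment_zero_right (Y : Ω → ℝ) (P : Measure Ω) (n : ℕ) :
    expMoment Y P n 0 = ∫ ω, Y ω ^ n ∂P := by
  simp [expMoment]

theorem exp_mul_le_one_add_exp_mul {u c y : ℝ} (hu : u ∈ Set.Icc 0 c) :
    Real.exp (u * y) ≤ 1 + Real.exp (c * y) := by
  rcases le_total 0 y with hy | hy
  · have hle := Real.exp_le_exp.2 (mul_le_mul_of_nonneg_right hu.2 hy)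
    linarith
  · have hle := Real.exp_le_one_iff.2 (mul_nonpos_of_nonneg_of_nonpos hu.1 hy)
    linarith [Real.exp_pos (c * y)]

variable [IsFiniteMeasure P]

theorem Ioo_subset_interior_integrableExpSet
    (hb : Integrable (fun ω ↦ Real.exp (b * Y ω)) P) :
    Set.Ioo 0 b ⊆ interior (integrableExpSet Y P) :=
  interior_maximal (fun _ hu ↦ integrable_exp_mul_of_nonneg_of_le hb hu.1.le hu.2.le) isOpen_Ioo

theorem continuousOn_expMoment (hY : MemLp Y n P)
    (hb : Integrable (fun ω ↦ Real.exp (b * Y ω)) P) (hc : 0 < c) (hcb : c < b) :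
    ContinuousOn (expMoment Y P n) (Set.Icc 0 c) := by
  have hint := integrable_pow_abs_mul_exp_of_mem_interior_integrableExpSet
    (Ioo_subset_interior_integrableExpSet hb ⟨hc, hcb⟩) n
  refine continuousOn_of_dominated (bound := fun ω ↦ |Y ω| ^ n + |Y ω| ^ n * Real.exp (c * Y ω))
    (fun u _ ↦ (hY.aestronglyMeasurable.pow n).mul
      (Real.continuous_exp.comp_aestronglyMeasurable (hY.aestronglyMeasurable.const_mul u)))
    (fun u hu ↦ ae_of_all _ fun ω ↦ ?_) (hY.integrable_norm_pow'.add hint)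
    (ae_of_all _ fun ω ↦ by fun_prop)
  calc ‖Y ω ^ n * Real.exp (u * Y ω)‖ = |Y ω| ^ n * Real.exp (u * Y ω) := by simp
    _ ≤ |Y ω| ^ n * (1 + Real.exp (c * Y ω)) := by gcongr; exact exp_mul_le_one_add_exp_mul hu
    _ = _ := by ring

theorem hasDerivWithinAt_expMoment (hY : MemLp Y (n + 1 : ℕ) P)
    (hb : Integrable (fun ω ↦ Real.exp (b * Y ω)) P) (hc : 0 < c) (hcb : c < b) {u : ℝ}
    (hu : u ∈ Set.Icc 0 c) :
    HasDerivWithinAt (expMoment Y P n) (expMoment Y P (n + 1) u) (Set.Icc 0 c) u := by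
  have hderiv : ∀ x ∈ Set.Ioo 0 b, HasDerivAt (expMoment Y P n) (expMoment Y P (n + 1) x) x :=
    fun x hx ↦ hasDerivAt_integral_pow_mul_exp_real (Ioo_subset_interior_integrableExpSet hb hx) n
  rcases hu.1.eq_or_lt with rfl | hpos
  · have hIoo : Set.Ioo 0 c ⊆ Set.Ioo 0 b := Set.Ioo_subset_Ioo_right hcb.le
    have hYn : MemLp Y n P := hY.mono_exponent (by exact_mod_cast n.le_succ)
    have hcont := (continuousOn_expMoment hYn hb hc hcb 0 hu).mono Set.Ioo_subset_Icc_self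
    have hlim := (continuousOn_expMoment hY hb hc hcb 0 hu).mono Set.Ioo_subset_Icc_self
    rw [ContinuousWithinAt, nhdsWithin_Ioo_eq_nhdsGT hc] at hlim
    refine (hasDerivWithinAt_Ici_of_tendsto_deriv
      (fun x hx ↦ (hderiv x (hIoo hx)).differentiableAt.differentiableWithinAt) hcont
      (Ioo_mem_nhdsGT hc) (hlim.congr' ?_)).mono Set.Icc_subset_Ici_self
    filter_upwards [Ioo_mem_nhdsGT hc] with x hx using (hderiv x (hIoo hx)).deriv.symm
  · exact (hderiv u ⟨hpos, hu.2.trans_lt hcb⟩).hasDerivWithinAt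

theorem contDiffOn_mgf (hY : MemLp Y n P) (hb : Integrable (fun ω ↦ Real.exp (b * Y ω)) P)
    (hc : 0 < c) (hcb : c < b) : ContDiffOn ℝ n (mgf Y P) (Set.Icc 0 c) := by
  rw [← expMoment_zero_left]
  exact contDiffOn_of_hasDerivWithinAt (uniqueDiffOn_Icc hc)
    (fun k hk x hx ↦ hasDerivWithinAt_expMoment (hY.mono_exponent (by exact_mod_cast hk)) hb hc
      hcb hx) (continuousOn_expMoment hY hb hc hcb)

theorem iteratedDerivWithin_mgf_zero (hY : MemLp Y n P)
    (hb : Integrable (fun ω ↦ Real.exp (b * Y ω)) P) (hc : 0 < c) (hcb : c < b) :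
    iteratedDerivWithin n (mgf Y P) (Set.Icc 0 c) 0 = ∫ ω, Y ω ^ n ∂P := by
  rw [← expMoment_zero_left, ← expMoment_zero_right]
  exact iteratedDerivWithin_eq_of_hasDerivWithinAt (uniqueDiffOn_Icc hc)
    (f := expMoment Y P)
    (fun k hk x hx ↦ hasDerivWithinAt_expMoment (hY.mono_exponent (by exact_mod_cast hk)) hb hc
      hcb hx) le_rfl ⟨le_rfl, hc.le⟩

theorem exists_contDiff_eqOn_cgf [NeZero P] (hY : MemLp Y n P)
    (hb : Integrable (fun ω ↦ Real.exp (b * Y ω)) P) (hc : 0 < c) (hcb : c < b) :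
    ∃ K, ContDiff ℝ n K ∧ Set.EqOn K (cgf Y P) (Set.Icc 0 c) ∧
      ∀ k ≤ n, iteratedDeriv k (fun u ↦ Real.exp (K u)) 0 = ∫ ω, Y ω ^ k ∂P := by
  have hint : ∀ u ∈ Set.Icc 0 c, Integrable (fun ω ↦ Real.exp (u * Y ω)) P := fun u hu ↦
    integrable_exp_mul_of_nonneg_of_le hb hu.1 (hu.2.trans hcb.le)
  obtain ⟨K, hK, hKcgf⟩ := exists_contDiff_eqOn_Icc hc
    ((contDiffOn_mgf hY hb hc hcb).log fun u hu ↦ (mgf_pos' (NeZero.ne P) (hint u hu)).ne')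
  have hexp : Set.EqOn (fun u ↦ Real.exp (K u)) (mgf Y P) (Set.Icc 0 c) := fun u hu ↦
    (congrArg Real.exp (hKcgf hu)).trans (Real.exp_log (mgf_pos' (NeZero.ne P) (hint u hu)))
  have hzero : (0 : ℝ) ∈ Set.Icc 0 c := ⟨le_rfl, hc.le⟩
  refine ⟨K, hK, hKcgf, fun k hk ↦ ?_⟩
  have hk' : (k : WithTop ℕ∞) ≤ n := by exact_mod_cast hk
  rw [← iteratedDerivWithin_mgf_zero (hY.mono_exponent (by exact_mod_cast hk)) hb hc hcb,
    ← iteratedDerivWithin_congr hexp hzero, iteratedDerivWithin_eq_iteratedDeriv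
      (uniqueDiffOn_Icc hc) (hK.exp.of_le hk').contDiffAt hzero]

end MomentGeneratingFunction

theorem iteratedDeriv_succ_exp_comp {n : ℕ} {K : ℝ → ℝ} (hK : ContDiff ℝ (n + 1) K) (x : ℝ) :
    iteratedDeriv (n + 1) (fun u ↦ Real.exp (K u)) x =
      ∑ i ∈ Finset.range (n + 1), n.choose i * iteratedDeriv (i + 1) K x *
        iteratedDeriv (n - i) (fun u ↦ Real.exp (K u)) x := by
  have hderiv : deriv (fun u ↦ Real.exp (K u)) = deriv K * fun u ↦ Real.exp (K u) := by
    ext u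
    simpa [mul_comm] using ((hK.differentiable (by simp)) u).hasDerivAt.exp.deriv
  rw [iteratedDeriv_succ', hderiv, iteratedDeriv_mul (contDiff_succ_iff_deriv.1 hK).2.2.contDiffAt
    (hK.exp.of_le le_self_add).contDiffAt]
  simp only [iteratedDeriv_succ']

theorem exists_contDiff_cgf_eq_sq_mul {Ω : Type*} [MeasurableSpace Ω] {P : Measure Ω}
    [IsProbabilityMeasure P] {Y : Ω → ℝ} {b c : ℝ} (hY : MemLp Y 4 P) (hmean : P[Y] = 0)
    (hb : Integrable (fun ω ↦ Real.exp (b * Y ω)) P) (hc : 0 < c) (hcb : c < b) :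
    ∃ F, ContDiff ℝ 2 F ∧ (∀ u ∈ Set.Icc 0 c, cgf Y P u = u ^ 2 * F u) ∧
      F 0 = (∫ ω, Y ω ^ 2 ∂P) / 2 ∧ deriv F 0 = (∫ ω, Y ω ^ 3 ∂P) / 6 ∧
      iteratedDeriv 2 F 0 = ((∫ ω, Y ω ^ 4 ∂P) - 3 * (∫ ω, Y ω ^ 2 ∂P) ^ 2) / 12 := by
  obtain ⟨K, hK, hKcgf, hmoment⟩ := exists_contDiff_eqOn_cgf (n := 4) hY hb hc hcb
  obtain ⟨F, hF, hKF, hFK⟩ := exists_contDiff_eq_add_sq_mul (n := 2) hK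
  have hrec := fun n (hn : n ≤ 3) ↦ iteratedDeriv_succ_exp_comp (n := n)
    (hK.of_le (by norm_cast; omega)) 0
  have hK0 : K 0 = 0 := by rw [hKcgf ⟨le_rfl, hc.le⟩, cgf_zero]
  have hK1 : deriv K 0 = 0 := by simpa [hmoment, hmean] using (hrec 0 (by norm_num)).symm
  have hK2 : iteratedDeriv 2 K 0 = ∫ ω, Y ω ^ 2 ∂P := by
    simpa [Finset.sum_range_succ, hmoment, hmean] using (hrec 1 (by norm_num)).symm
  have hK3 : iteratedDeriv 3 K 0 = ∫ ω, Y ω ^ 3 ∂P := by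
    simpa [Finset.sum_range_succ, hmoment, hmean, hK1] using (hrec 2 (by norm_num)).symm
  have hK4 : iteratedDeriv 4 K 0 = (∫ ω, Y ω ^ 4 ∂P) - 3 * (∫ ω, Y ω ^ 2 ∂P) ^ 2 := by
    have h : ∫ ω, Y ω ^ 4 ∂P =
        3 * (∫ ω, Y ω ^ 2 ∂P) * (∫ ω, Y ω ^ 2 ∂P) + iteratedDeriv 4 K 0 := by
      simpa [Finset.sum_range_succ, hmoment, hmean, hK1, hK2, Nat.choose] using
        hrec 3 (by norm_num)
    rw [h]
    ring
  refine ⟨F, hF, fun u hu ↦ ?_, ?_, ?_, ?_⟩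
  · rw [← hKcgf hu, hKF u, hK0, hK1]
    ring
  · rw [← iteratedDeriv_zero (f := F), hFK 0 zero_le_two]
    norm_num [hK2]
  · rw [← iteratedDeriv_one, hFK 1 one_le_two]
    norm_num [hK3]
  · rw [hFK 2 le_rfl]
    norm_num [hK4]

/-- The quotient `(κ(u) - μ u) / u²`, where `κ` is the cumulant generating function of `Y` and
`μ = E[Y]`, extended to `u = 0` by its limit `Var(Y) / 2`. -/
noncomputable def cumulantQuotient {Ω : Type*} [MeasurableSpace Ω] (Y : Ω → ℝ) (P : Measure Ω)
    (u : ℝ) : ℝ :=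
  if u = 0 then variance Y P / 2 else (cgf Y P u - P[Y] * u) / u ^ 2

theorem cumulantQuotient_zero {Ω : Type*} [MeasurableSpace Ω] (Y : Ω → ℝ) (P : Measure Ω) :
    cumulantQuotient Y P 0 = variance Y P / 2 :=
  if_pos rfl

theorem cgf_eq_add_sq_mul_cumulantQuotient {Ω : Type*} [MeasurableSpace Ω] (Y : Ω → ℝ)
    (P : Measure Ω) [IsZeroOrProbabilityMeasure P] (u : ℝ) :
    cgf Y P u = P[Y] * u + u ^ 2 * cumulantQuotient Y P u := by
  rcases eq_or_ne u 0 with rfl | hu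
  · simp
  · rw [cumulantQuotient, if_neg hu]
    field_simp
    ring

theorem exists_contDiff_eqOn_cumulantQuotient {Ω : Type*} [MeasurableSpace Ω] {P : Measure Ω}
    [IsProbabilityMeasure P] {Y : Ω → ℝ} {b c : ℝ} (hY : MemLp Y 4 P)
    (hb : Integrable (fun ω ↦ Real.exp (b * Y ω)) P) (hc : 0 < c) (hcb : c < b) :
    ∃ F, ContDiff ℝ 2 F ∧ Set.EqOn (cumulantQuotient Y P) F (Set.Icc 0 c) ∧
      F 0 = variance Y P / 2 ∧ deriv F 0 = centralMoment Y 3 P / 6 ∧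
      iteratedDeriv 2 F 0 = (centralMoment Y 4 P - 3 * variance Y P ^ 2) / 12 := by
  set Z : Ω → ℝ := fun ω ↦ Y ω - P[Y] with hZ
  have hYint : Integrable Y P := hY.integrable (by norm_num)
  have hmean : P[Z] = 0 := by simp [hZ, integral_sub hYint]
  have hexp : ∀ u ω, Real.exp (u * Z ω) = Real.exp (u * Y ω) * Real.exp (-(u * P[Y])) :=
    fun u ω ↦ by rw [← Real.exp_add, hZ]; ring_nf
  have hZb : Integrable (fun ω ↦ Real.exp (b * Z ω)) P := by
    simpa only [hexp] using hb.mul_const _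
  have hZ4 : MemLp Z 4 P := hY.sub (memLp_const _)
  obtain ⟨F, hF, hcgf, hF0, hF1, hF2⟩ := exists_contDiff_cgf_eq_sq_mul hZ4 hmean hZb hc hcb
  rw [← variance_eq_integral hYint.aemeasurable] at hF0 hF2
  refine ⟨F, hF, fun u hu ↦ ?_, hF0, hF1, hF2⟩
  rcases eq_or_ne u 0 with rfl | hne
  · rw [cumulantQuotient_zero, hF0]
  have hpos : 0 < mgf Z P u :=
    mgf_pos (integrable_exp_mul_of_nonneg_of_le hZb hu.1 (hu.2.trans hcb.le))
  have hmgf : mgf Y P u = mgf Z P u * Real.exp (u * P[Y]) := by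
    rw [← mgf_add_const]
    simp [hZ]
  have hsplit : cgf Y P u = cgf Z P u + u * P[Y] := by
    rw [cgf, hmgf, Real.log_mul hpos.ne' (Real.exp_pos _).ne', Real.log_exp, cgf]
  rw [cumulantQuotient, if_neg hne, hsplit, hcgf u hu]
  field_simp
  ring

/-- The mean-variance ratio `κ(1) / (κ(2) - 2 κ(1))` at the parameter `x`, for the cumulant
generating function `κ(u) = μ u + u² F(u x)`. -/
noncomputable def ratioOfQuotient (μ : ℝ) (F : ℝ → ℝ) (x : ℝ) : ℝ :=
  (μ + F x) / (4 * F (2 * x) - 2 * F x)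

section RatioOfQuotient

variable {F : ℝ → ℝ} {n : ℕ}

theorem contDiffAt_ratioOfQuotient (hF : ContDiff ℝ n F) (μ : ℝ) {x : ℝ}
    (hne : 4 * F (2 * x) - 2 * F x ≠ 0) : ContDiffAt ℝ n (ratioOfQuotient μ F) x := by
  unfold ratioOfQuotient
  fun_prop (disch := assumption)

theorem iteratedDeriv_ratioOfQuotient_denominator (hF : ContDiff ℝ n F) :
    iteratedDeriv n (fun x ↦ 4 * F (2 * x) - 2 * F x) 0 =
      (4 * 2 ^ n - 2) * iteratedDeriv n F 0 := by
  have hsub := iteratedDeriv_sub (n := n) (f := fun x ↦ 4 * F (2 * x)) (g := fun x ↦ 2 * F x)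
    (x := 0) (by fun_prop) (by fun_prop)
  rw [iteratedDeriv_const_mul_field, iteratedDeriv_const_mul_field,
    iteratedDeriv_comp_const_mul hF] at hsub
  refine hsub.trans ?_
  simp only [mul_zero]
  ring

theorem iteratedDeriv_eq_sum_ratioOfQuotient (hF : ContDiff ℝ n F) (hF0 : F 0 ≠ 0) (hn : 0 < n)
    (μ : ℝ) : iteratedDeriv n F 0 = ∑ i ∈ Finset.range (n + 1),
      n.choose i * iteratedDeriv i (ratioOfQuotient μ F) 0 *
        ((4 * 2 ^ (n - i) - 2) * iteratedDeriv (n - i) F 0) := by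
  set D : ℝ → ℝ := fun x ↦ 4 * F (2 * x) - 2 * F x with hD
  have hD_contDiff : ContDiff ℝ n D := by fun_prop
  have hD_zero : D 0 ≠ 0 := by
    rw [hD]
    ring_nf
    positivity
  have hmul : ratioOfQuotient μ F * D =ᶠ[𝓝 0] fun x ↦ μ + F x := by
    filter_upwards [hD_contDiff.continuous.continuousAt.eventually_ne hD_zero] with x hx
    exact div_mul_cancel₀ _ hx
  rw [← iteratedDeriv_const_add hn μ, ← hmul.iteratedDeriv_eq n,
    iteratedDeriv_mul (contDiffAt_ratioOfQuotient hF μ hD_zero) hD_contDiff.contDiffAt]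
  refine Finset.sum_congr rfl fun i _ ↦ ?_
  rw [iteratedDeriv_ratioOfQuotient_denominator
    (hF.of_le (by exact_mod_cast Nat.sub_le n i))]

theorem ratioOfQuotient_zero (μ : ℝ) (F : ℝ → ℝ) :
    ratioOfQuotient μ F 0 = (μ + F 0) / (2 * F 0) := by
  rw [ratioOfQuotient, mul_zero]
  ring_nf

theorem deriv_ratioOfQuotient_zero (hF : ContDiff ℝ 1 F) (hF0 : F 0 ≠ 0) (μ : ℝ) :
    deriv (ratioOfQuotient μ F) 0 =
      (1 - 6 * ratioOfQuotient μ F 0) * deriv F 0 / (2 * F 0) := by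
  have hsum := iteratedDeriv_eq_sum_ratioOfQuotient (n := 1) hF hF0 one_pos μ
  norm_num [Finset.sum_range_succ] at hsum
  rw [eq_div_iff (by positivity)]
  linarith

theorem iteratedDeriv_two_ratioOfQuotient_zero (hF : ContDiff ℝ 2 F) (hF0 : F 0 ≠ 0) (μ : ℝ) :
    iteratedDeriv 2 (ratioOfQuotient μ F) 0 =
      ((1 - 14 * ratioOfQuotient μ F 0) * iteratedDeriv 2 F 0 -
        12 * deriv (ratioOfQuotient μ F) 0 * deriv F 0) / (2 * F 0) := by
  have hsum := iteratedDeriv_eq_sum_ratioOfQuotient (n := 2) hF hF0 two_pos μ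
  norm_num [Finset.sum_range_succ] at hsum
  rw [eq_div_iff (by positivity)]
  linarith

end RatioOfQuotient

section Cumulants

variable {Ω Ω' : Type*} [MeasurableSpace Ω] [MeasurableSpace Ω'] {P : Measure Ω}
  {P' : Measure Ω'}

theorem two_mul_cgf_lt_cgf_two_mul [IsProbabilityMeasure P] {Y : Ω → ℝ} {x : ℝ} (hx : x ≠ 0)
    (hY : AEMeasurable Y P) (hexp : Integrable (fun ω ↦ Real.exp (2 * x * Y ω)) P)
    (hvar : variance Y P ≠ 0) : 2 * cgf Y P x < cgf Y P (2 * x) := by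
  set Z : Ω → ℝ := fun ω ↦ Real.exp (x * Y ω) with hZ
  have hZ_sq : (fun ω ↦ Z ω ^ 2) = fun ω ↦ Real.exp (2 * x * Y ω) := by
    ext ω
    rw [hZ, ← Real.exp_nat_mul, Nat.cast_ofNat, mul_assoc]
  have hZ_meas : AEMeasurable Z P := by fun_prop
  have hZ_memLp : MemLp Z 2 P :=
    (memLp_two_iff_integrable_sq hZ_meas.aestronglyMeasurable).2 (hZ_sq ▸ hexp)
  have hZ_var : variance Z P ≠ 0 := by
    intro hzero
    have hconst : Y =ᵐ[P] fun _ ↦ Real.log (P[Z]) / x := by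
      filter_upwards [ae_eq_integral_of_variance_eq_zero hZ_memLp hzero] with ω hω
      rw [← hω, hZ, Real.log_exp, mul_div_cancel_left₀ _ hx]
    exact hvar (by rw [variance_congr hconst, variance_eq_integral (by fun_prop)]; simp)
  have hpos : 0 < mgf Y P (2 * x) - mgf Y P x ^ 2 := by
    have h := (variance_nonneg Z P).lt_of_ne' hZ_var
    rw [variance_eq_sub hZ_memLp] at h
    simp only [Pi.pow_apply, hZ_sq] at h
    exact h
  have hmgf := mgf_pos (hZ_memLp.integrable one_le_two)
  have hlog := Real.log_lt_log (by positivity) (sub_pos.1 hpos)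
  rwa [Real.log_pow] at hlog

theorem cumulantGenFun_ofReal {Y : ℝ≥0 → Ω → ℝ} {u w : ℝ}
    (hmgf : ∀ t : ℝ≥0, mgf (Y t) P u = Real.exp (t * w)) :
    cumulantGenFun Y P (u : ℂ) = w := by
  have hmem : (u : ℂ) ∈ expDomain Y P := by
    by_contra hnot
    have hzero : mgf (Y 1) P u = 0 := mgf_undef (by simpa [expDomain] using hnot)
    exact (Real.exp_pos _).ne (hzero ▸ hmgf 1)
  have hint : ∀ t : ℝ≥0, ∫ ω, Complex.exp ((u : ℂ) * (Y t ω : ℂ)) ∂P =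
      Complex.exp ((t : ℂ) * (w : ℂ)) := fun t ↦ by
    exact_mod_cast (integral_complex_ofReal.trans (congrArg Complex.ofReal (hmgf t)))
  have hex : (u : ℂ) ∈ expDomain Y P ∧ ∃ w : ℂ, ∀ t : ℝ≥0,
      ∫ ω, Complex.exp ((u : ℂ) * (Y t ω : ℂ)) ∂P = Complex.exp ((t : ℂ) * w) := ⟨hmem, w, hint⟩
  rw [cumulantGenFun, dif_pos hex]
  exact eq_of_exp_mul_eq fun t ↦ by rw [← hex.2.choose_spec t, hint t]

theorem cumulantGenFun_levyCurve [IsProbabilityMeasure P] {X : ℝ≥0 → Ω → ℝ}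
    (hX : IsLevyProcess X P) {l u : ℝ} (hl : 0 < l)
    (hint : Integrable (fun ω ↦ Real.exp (u * l * X 1 ω)) P) :
    cumulantGenFun (levyCurve X P l) P (u : ℂ) =
      (u * (1 - 1 / l) * driftRate X P + cgf (X 1) P (u * l) / l ^ 2 : ℝ) := by
  refine cumulantGenFun_ofReal fun t ↦ ?_
  unfold levyCurve
  rw [mgf_const_add, mgf_const_mul, mul_comm l u, hX.mgf_eq_exp hint, ← Real.exp_add,
    NNReal.coe_div, NNReal.coe_pow, Real.coe_toNNReal l hl.le]
  ring_nf

theorem cumulantGenFun_brownianLimit (X : ℝ≥0 → Ω → ℝ) {W : ℝ≥0 → Ω' → ℝ}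
    (hW : IsPreBrownianReal W P') (u : ℝ) :
    cumulantGenFun (brownianLimit X P W) P' (u : ℂ) =
      (u * driftRate X P + u ^ 2 * (variance (X 1) P / 2) : ℝ) := by
  refine cumulantGenFun_ofReal fun t ↦ ?_
  have hvol : volatility X P ^ 2 = variance (X 1) P := Real.sq_sqrt (variance_nonneg _ _)
  unfold brownianLimit
  rw [mgf_const_add, mgf_const_mul, mgf_gaussianReal (hW.hasLaw_eval t).map_eq, ← Real.exp_add,
    mul_pow, hvol]
  ring_nf

variable [IsProbabilityMeasure P] {X : ℝ≥0 → Ω → ℝ} {W : ℝ≥0 → Ω' → ℝ}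

theorem curveCumulant_ofReal (hX : IsLevyProcess X P) (hW : IsPreBrownianReal W P') {l u : ℝ}
    (hl : 0 ≤ l) (hint : Integrable (fun ω ↦ Real.exp (u * l * X 1 ω)) P) :
    curveCumulant X P W P' l (u : ℂ) =
      (u * driftRate X P + u ^ 2 * cumulantQuotient (X 1) P (u * l) : ℝ) := by
  rcases hl.eq_or_lt with rfl | hpos
  · rw [curveCumulant, if_pos rfl, cumulantGenFun_brownianLimit X hW, mul_zero,
      cumulantQuotient_zero]
  · rw [curveCumulant, if_neg hpos.ne', cumulantGenFun_levyCurve hX hpos hint,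
      cgf_eq_add_sq_mul_cumulantQuotient, driftRate]
    congr 1
    field_simp
    ring

theorem meanVarianceRatio_eq (hX : IsLevyProcess X P) (hW : IsPreBrownianReal W P') {l : ℝ}
    (hl : 0 ≤ l) (hint : Integrable (fun ω ↦ Real.exp (2 * l * X 1 ω)) P) :
    meanVarianceRatio X P W P' l =
      (ratioOfQuotient (driftRate X P) (cumulantQuotient (X 1) P) l : ℝ) := by
  have hint_one : Integrable (fun ω ↦ Real.exp (1 * l * X 1 ω)) P :=
    integrable_exp_mul_of_nonneg_of_le hint (by linarith) (by linarith)
  have hone := curveCumulant_ofReal hX hW hl (u := 1) hint_one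
  have htwo := curveCumulant_ofReal hX hW hl (u := 2) hint
  simp only [Complex.ofReal_one, one_mul, one_pow, Complex.ofReal_ofNat] at hone htwo
  rw [meanVarianceRatio, kappaBar, one_add_one_eq_two, hone, htwo, ratioOfQuotient]
  push_cast
  congr 1
  ring

theorem cumulantQuotient_denominator_pos {Y : Ω → ℝ} (hY : AEMeasurable Y P)
    (hvar : 0 < variance Y P) {x : ℝ} (hexp : Integrable (fun ω ↦ Real.exp (2 * x * Y ω)) P) :
    0 < 4 * cumulantQuotient Y P (2 * x) - 2 * cumulantQuotient Y P x := by
  rcases eq_or_ne x 0 with rfl | hx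
  · rw [mul_zero, cumulantQuotient_zero]
    linarith
  · have hcgf := two_mul_cgf_lt_cgf_two_mul hx hY hexp hvar.ne'
    rw [cgf_eq_add_sq_mul_cumulantQuotient, cgf_eq_add_sq_mul_cumulantQuotient] at hcgf
    refine pos_of_mul_pos_right (a := x ^ 2) ?_ (sq_nonneg x)
    linarith

end Cumulants

theorem iteratedDeriv_ofReal_comp {f : ℝ → ℝ} {n : ℕ} {x : ℝ} (hf : ContDiffAt ℝ n f x) :
    iteratedDeriv n (fun y ↦ (f y : ℂ)) x = (iteratedDeriv n f x : ℝ) := by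
  have hcomp := Complex.ofRealCLM.iteratedFDeriv_comp_left hf le_rfl
  exact congrArg (· fun _ ↦ 1) hcomp

theorem approxTerm_eq_iteratedDeriv {q : ℝ → ℂ} {f : ℝ → ℝ} {n : ℕ} {c : ℝ} (hc : 0 < c)
    (hf : ContDiffAt ℝ n f 0) (hqf : Set.EqOn q (fun x ↦ (f x : ℂ)) (Set.Icc 0 c)) :
    approxTerm q n = (iteratedDeriv n f 0 : ℝ) := by
  have hf_ofReal : ContDiffAt ℝ n (fun x ↦ (f x : ℂ)) 0 :=
    Complex.ofRealCLM.contDiff.contDiffAt.comp 0 hf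
  have hgerm : q =ᶠ[𝓝[Set.Icc 0 1] 0] fun x ↦ (f x : ℂ) := by
    filter_upwards [self_mem_nhdsWithin, mem_nhdsWithin_of_mem_nhds (Iic_mem_nhds hc)]
      with x hx hxc using hqf ⟨hx.1, hxc⟩
  rw [approxTerm, hgerm.iteratedDerivWithin_eq (hqf ⟨le_rfl, hc.le⟩),
    iteratedDerivWithin_eq_iteratedDeriv (uniqueDiffOn_Icc zero_lt_one) hf_ofReal
      ⟨le_rfl, zero_le_one⟩, iteratedDeriv_ofReal_comp hf]

theorem exists_gt_integrable_exp_of_mem_interior_expDomain {Ω : Type*} [MeasurableSpace Ω]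
    {P : Measure Ω} {Y : ℝ≥0 → Ω → ℝ} {a : ℝ} (ha : (a : ℂ) ∈ interior (expDomain Y P)) :
    ∃ b > a, Integrable (fun ω ↦ Real.exp (b * Y 1 ω)) P := by
  have hnhds : ∀ᶠ x : ℝ in 𝓝 a, (x : ℂ) ∈ expDomain Y P :=
    Complex.continuous_ofReal.continuousAt.eventually (mem_interior_iff_mem_nhds.1 ha)
  obtain ⟨b, hb, hab⟩ := ((hnhds.filter_mono nhdsWithin_le_nhds).and
    (self_mem_nhdsWithin (s := Set.Ioi a))).exists
  exact ⟨b, hab, by simpa [expDomain] using hb⟩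

theorem MomentConditions.memLp_four {Ω : Type*} [MeasurableSpace Ω] {P : Measure Ω}
    {X : ℝ≥0 → Ω → ℝ} (hmom : MomentConditions X P) (hX : Measurable (X 1)) :
    MemLp (X 1) 4 P := by
  rw [← integrable_norm_rpow_iff hX.aestronglyMeasurable (by norm_num) (by norm_num)]
  exact_mod_cast hmom.moments 4 (by simp)

theorem centralMoment_three_eq_skewness_mul {Ω : Type*} [MeasurableSpace Ω] {P : Measure Ω}
    {Y : Ω → ℝ} (hvar : 0 < variance Y P) :
    centralMoment Y 3 P = skewness Y P * √(variance Y P) ^ 3 :=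
  (div_mul_cancel₀ _ (by positivity)).symm

theorem centralMoment_four_eq_excessKurtosis_mul {Ω : Type*} [MeasurableSpace Ω] {P : Measure Ω}
    {Y : Ω → ℝ} (hvar : 0 < variance Y P) :
    centralMoment Y 4 P = (excessKurtosis Y P + 3) * √(variance Y P) ^ 4 := by
  rw [excessKurtosis, sub_add_cancel]
  exact (div_mul_cancel₀ _ (by positivity)).symm

section MeanVarianceRatio

variable {Ω Ω' : Type*} [MeasurableSpace Ω] [MeasurableSpace Ω'] {P : Measure Ω}
  [IsProbabilityMeasure P] {P' : Measure Ω'} {X : ℝ≥0 → Ω → ℝ} {W : ℝ≥0 → Ω' → ℝ} {b c : ℝ}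

theorem exists_contDiff_meanVarianceRatio_eqOn (hX : IsLevyProcess X P)
    (hW : IsPreBrownianReal W P') (hmem : MemLp (X 1) 4 P) (hvar : 0 < variance (X 1) P)
    (hb : Integrable (fun ω ↦ Real.exp (b * X 1 ω)) P) (hc : 0 < c) (hcb : c < b / 2) :
    ∃ F, ContDiff ℝ 2 F ∧ F 0 = variance (X 1) P / 2 ∧
      deriv F 0 = centralMoment (X 1) 3 P / 6 ∧
      iteratedDeriv 2 F 0 = (centralMoment (X 1) 4 P - 3 * variance (X 1) P ^ 2) / 12 ∧
      (∀ l ∈ Set.Icc 0 c, 4 * F (2 * l) - 2 * F l ≠ 0) ∧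
      Set.EqOn (meanVarianceRatio X P W P') (fun l ↦ (ratioOfQuotient (driftRate X P) F l : ℂ))
        (Set.Icc 0 c) := by
  obtain ⟨F, hF, hquot, hF0, hF1, hF2⟩ :=
    exists_contDiff_eqOn_cumulantQuotient hmem hb (c := 2 * c) (by linarith) (by linarith)
  have hint : ∀ l ∈ Set.Icc 0 c, Integrable (fun ω ↦ Real.exp (2 * l * X 1 ω)) P := fun l hl ↦
    integrable_exp_mul_of_nonneg_of_le hb (by linarith [hl.1]) (by linarith [hl.2])
  have hquot_two : ∀ l ∈ Set.Icc 0 c, cumulantQuotient (X 1) P (2 * l) = F (2 * l) :=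
    fun l hl ↦ hquot ⟨by linarith [hl.1], by linarith [hl.2]⟩
  have hquot_one : ∀ l ∈ Set.Icc 0 c, cumulantQuotient (X 1) P l = F l :=
    fun l hl ↦ hquot ⟨hl.1, by linarith [hl.2]⟩
  refine ⟨F, hF, hF0, hF1, hF2, fun l hl ↦ ?_, fun l hl ↦ ?_⟩
  · rw [← hquot_two l hl, ← hquot_one l hl]
    exact (cumulantQuotient_denominator_pos (hX.measurable 1).aemeasurable hvar (hint l hl)).ne'
  · simp only [meanVarianceRatio_eq hX hW hl.1 (hint l hl), ratioOfQuotient, hquot_two l hl,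
      hquot_one l hl]

theorem contDiffOn_meanVarianceRatio_Icc (hX : IsLevyProcess X P)
    (hW : IsPreBrownianReal W P') (hmem : MemLp (X 1) 4 P) (hvar : 0 < variance (X 1) P)
    (hb : Integrable (fun ω ↦ Real.exp (b * X 1 ω)) P) (hc : 0 < c) (hcb : c < b / 2) :
    ContDiffOn ℝ 2 (meanVarianceRatio X P W P') (Set.Icc 0 c) := by
  obtain ⟨F, hF, -, -, -, hne, heq⟩ :=
    exists_contDiff_meanVarianceRatio_eqOn hX hW hmem hvar hb hc hcb
  refine ContDiffOn.congr (fun l hl ↦ ?_) heq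
  exact (Complex.ofRealCLM.contDiff.contDiffAt.comp l
    (contDiffAt_ratioOfQuotient (n := 2) hF _ (hne l hl))).contDiffWithinAt

theorem contDiffOn_meanVarianceRatio_Ico (hX : IsLevyProcess X P)
    (hW : IsPreBrownianReal W P') (hmem : MemLp (X 1) 4 P) (hvar : 0 < variance (X 1) P)
    (hb : Integrable (fun ω ↦ Real.exp (b * X 1 ω)) P) :
    ContDiffOn ℝ 2 (meanVarianceRatio X P W P') (Set.Ico 0 (b / 2)) := by
  intro l hl
  obtain ⟨c, hlc, hcb⟩ := exists_between hl.2
  refine (contDiffOn_meanVarianceRatio_Icc hX hW hmem hvar hb (hl.1.trans_lt hlc) hcb l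
    ⟨hl.1, hlc.le⟩).mono_of_mem_nhdsWithin ?_
  filter_upwards [self_mem_nhdsWithin, mem_nhdsWithin_of_mem_nhds (Iic_mem_nhds hlc)]
    with x hx hxc using ⟨hx.1, hxc⟩

theorem approxTerm_meanVarianceRatio (hX : IsLevyProcess X P)
    (hW : IsPreBrownianReal W P') (hmem : MemLp (X 1) 4 P) (hvar : 0 < variance (X 1) P)
    (hb0 : 0 < b) (hb : Integrable (fun ω ↦ Real.exp (b * X 1 ω)) P)
    {μ σ Skew ExKurt Λ₀ Λ₁ : ℝ} (hμ : μ = driftRate X P) (hσ : σ = volatility X P)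
    (hSkew : Skew = skewness (X 1) P) (hExKurt : ExKurt = excessKurtosis (X 1) P)
    (hΛ₀ : Λ₀ = (μ + σ ^ 2 / 2) / σ ^ 2)
    (hΛ₁ : Λ₁ = Skew * σ * (1 / 6 - Λ₀)) :
    approxTerm (meanVarianceRatio X P W P') 0 = Λ₀ ∧
    approxTerm (meanVarianceRatio X P W P') 1 = Λ₁ ∧
    approxTerm (meanVarianceRatio X P W P') 2 = (Skew ^ 2 * σ ^ 2 * (2 * Λ₀ - 1 / 3)
      + 1 / 6 * ExKurt * σ ^ 2 * (1 / 2 - 7 * Λ₀) : ℝ) := by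
  obtain ⟨F, hF, hF0, hF1, hF2, hne, heq⟩ := exists_contDiff_meanVarianceRatio_eqOn hX hW hmem
    hvar hb (c := b / 4) (by linarith) (by linarith)
  have hσ_pos : 0 < σ := hσ ▸ Real.sqrt_pos.2 hvar
  have hσ_sq : σ ^ 2 = variance (X 1) P := hσ ▸ Real.sq_sqrt hvar.le
  rw [← hσ_sq] at hF0 hF2
  rw [centralMoment_three_eq_skewness_mul hvar, ← volatility, ← hσ, ← hSkew] at hF1
  rw [centralMoment_four_eq_excessKurtosis_mul hvar, ← volatility, ← hσ, ← hExKurt] at hF2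
  rw [← hμ] at heq
  have hF0_ne : F 0 ≠ 0 := by rw [hF0]; positivity
  have hzero : ratioOfQuotient μ F 0 = Λ₀ := by
    rw [ratioOfQuotient_zero, hF0, hΛ₀]
    ring
  have hone : deriv (ratioOfQuotient μ F) 0 = Λ₁ := by
    rw [deriv_ratioOfQuotient_zero (hF.of_le one_le_two) hF0_ne, hzero, hF0, hF1, hΛ₁]
    field_simp
  have htwo : iteratedDeriv 2 (ratioOfQuotient μ F) 0 = Skew ^ 2 * σ ^ 2 * (2 * Λ₀ - 1 / 3)
      + 1 / 6 * ExKurt * σ ^ 2 * (1 / 2 - 7 * Λ₀) := by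
    rw [iteratedDeriv_two_ratioOfQuotient_zero hF hF0_ne, hzero, hone, hF0, hF1, hF2, hΛ₁]
    field_simp
    ring
  have hterm : ∀ n : ℕ, n ≤ 2 → approxTerm (meanVarianceRatio X P W P') n =
      (iteratedDeriv n (ratioOfQuotient μ F) 0 : ℝ) := fun n hn ↦
    approxTerm_eq_iteratedDeriv (by linarith) (contDiffAt_ratioOfQuotient
      (hF.of_le (by exact_mod_cast hn)) _ (hne 0 ⟨le_rfl, by linarith⟩)) heq
  exact ⟨by rw [hterm 0 (by norm_num), iteratedDeriv_zero, hzero],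
    by rw [hterm 1 (by norm_num), iteratedDeriv_one, hone], by rw [hterm 2 le_rfl, htwo]⟩

end MeanVarianceRatio

theorem lemma3p5_general {Ω Ω' : Type*} [MeasurableSpace Ω] [MeasurableSpace Ω']
    (P : Measure Ω) [IsProbabilityMeasure P] (P' : Measure Ω')
    (X : ℝ≥0 → Ω → ℝ) (hX : IsLevyProcess X P) (hmem : MemLp (X 1) 4 P)
    (hvar : 0 < variance (X 1) P) {b : ℝ} (hb0 : 0 < b)
    (hb : Integrable (fun ω ↦ Real.exp (b * X 1 ω)) P)
    (W : ℝ≥0 → Ω' → ℝ) (hW : IsPreBrownianReal W P')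
    (μ σ Skew ExKurt Λ₀ Λ₁ Λ₂ : ℝ)
    (hμ : μ = driftRate X P) (hσ : σ = volatility X P)
    (hSkew : Skew = skewness (X 1) P) (hExKurt : ExKurt = excessKurtosis (X 1) P)
    (hΛ₀ : Λ₀ = (μ + σ ^ 2 / 2) / σ ^ 2)
    (hΛ₁ : Λ₁ = Skew * σ * (1 / 6 - Λ₀))
    (hΛ₂ : Λ₂ = Skew ^ 2 * σ ^ 2 * (2 * Λ₀ - 1 / 3)
      + 1 / 6 * ExKurt * σ ^ 2 * (1 / 2 - 7 * Λ₀)) :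
    ContDiffOn ℝ 2 (meanVarianceRatio X P W P') (Set.Ico 0 (b / 2)) ∧
    ((b : ℂ) ∈ interior (expDomain X P) →
      ContDiffOn ℝ 2 (meanVarianceRatio X P W P') (Set.Icc 0 (b / 2))) ∧
    approxTerm (meanVarianceRatio X P W P') 0 = Λ₀ ∧
    approxTerm (meanVarianceRatio X P W P') 1 = Λ₁ ∧
    approxTerm (meanVarianceRatio X P W P') 2 = Λ₂ ∧
    secondOrderApprox (meanVarianceRatio X P W P') = Λ₀ + Λ₁ + 1 / 2 * Λ₂ := by
  obtain ⟨hterm₀, hterm₁, hterm₂⟩ :=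
    approxTerm_meanVarianceRatio hX hW hmem hvar hb0 hb hμ hσ hSkew hExKurt hΛ₀ hΛ₁
  rw [← hΛ₂] at hterm₂
  refine ⟨contDiffOn_meanVarianceRatio_Ico hX hW hmem hvar hb, fun hmem_interior ↦ ?_,
    hterm₀, hterm₁, hterm₂, by rw [secondOrderApprox, hterm₀, hterm₁, hterm₂]⟩
  obtain ⟨b', hbb', hb'⟩ := exists_gt_integrable_exp_of_mem_interior_expDomain hmem_interior
  exact contDiffOn_meanVarianceRatio_Icc hX hW hmem hvar hb' (half_pos hb0)
    (div_lt_div_of_pos_right hbb' two_pos)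

theorem lemma3p5 {Ω Ω' : Type*} [MeasurableSpace Ω] [MeasurableSpace Ω']
    (P : Measure Ω) [IsProbabilityMeasure P] (P' : Measure Ω') [IsProbabilityMeasure P']
    (X : ℝ≥0 → Ω → ℝ) (hX : IsLevyProcess X P) (hmom : MomentConditions X P)
    (W : ℝ≥0 → Ω' → ℝ) (hW : IsBrownianReal W P')
    (μ σ Skew ExKurt Λ₀ Λ₁ Λ₂ : ℝ)
    (hμ : μ = driftRate X P) (hσ : σ = volatility X P)
    (hSkew : Skew = skewness (X 1) P) (hExKurt : ExKurt = excessKurtosis (X 1) P)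
    (hΛ₀ : Λ₀ = (μ + σ ^ 2 / 2) / σ ^ 2)
    (hΛ₁ : Λ₁ = Skew * σ * (1 / 6 - Λ₀))
    (hΛ₂ : Λ₂ = Skew ^ 2 * σ ^ 2 * (2 * Λ₀ - 1 / 3)
      + 1 / 6 * ExKurt * σ ^ 2 * (1 / 2 - 7 * Λ₀)) :
    ContDiffOn ℝ 2 (meanVarianceRatio X P W P') (Set.Ico 0 1) ∧
    ((2 : ℂ) ∈ interior (expDomain X P) →
      ContDiffOn ℝ 2 (meanVarianceRatio X P W P') (Set.Icc 0 1)) ∧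
    approxTerm (meanVarianceRatio X P W P') 0 = Λ₀ ∧
    approxTerm (meanVarianceRatio X P W P') 1 = Λ₁ ∧
    approxTerm (meanVarianceRatio X P W P') 2 = Λ₂ ∧
    secondOrderApprox (meanVarianceRatio X P W P') = Λ₀ + Λ₁ + 1 / 2 * Λ₂ := by
  simpa using lemma3p5_general P P' X hX (hmom.memLp_four (hX.measurable 1)) hmom.variance_pos
    two_pos hmom.expMoment W hW.toIsPreBrownianReal μ σ Skew ExKurt Λ₀ Λ₁ Λ₂ hμ hσ hSkew hExKurt
    hΛ₀ hΛ₁ hΛ₂
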